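/- Let $V:\mathbb R\to\mathbb R$ be continuous with $V(x+1)=V(x)$, let $\epsilon,\omega\in\mathbb R$ be arbitrary, and let $\phi\in C^2(\mathbb R;\mathbb R)$, $\phi\not\equiv 0$, be periodic ($\phi(x+1)=\phi(x)$) or antiperiodic ($\phi(x+1)=-\phi(x)$) and such that $\psi(x,t)=e^{-i\omega t}\phi(x)$ solves $i\psi_t=-\tfrac12\psi_{xx}+\epsilon|\psi|^2\psi+V(x)\psi$. Put $$L_-=-\tfrac12\partial_{xx}+V+\epsilon|\phi|^2-\omega,\qquad L_+=-\tfrac12\partial_{xx}+V+3\epsilon|\phi|^2-\omega .$$ The (Floquet) spectrum of the linearized stability problem $L_+p=-\mu q$, $L_-q=\mu p$ is the set of $\mu\in\mathbb C$ for which there are a number $\rho$ with $|\rho|=1$ and a nonzero pair $(p,q)$ of complex $C^2$ solutions with $p(x+1)=\rho\,p(x)$, $q(x+1)=\rho\,q(x)$, i.e. for which the period map has an eigenvalue on the unit circle. The Floquet spectrum of $L_+$ is the set of real $\lambda$ for which $L_+f=\lambda f$ has a nonzero solution with $f(x+1)=\rho f(x)$, $|\rho|=1$; its band edges are the $\lambda$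 for which there is one with $\rho=1$ or $\rho=-1$; a band is an interval $[a,b]$, $a<b$, whose end points are band edges and whose interior $(a,b)$ lies in the spectrum and contains no band edge. If $0$ lies in the interior of a band of $L_+$, then there is a modulational instability: the spectrum of the stability problem contains a segment $\{it: |t|<\delta\}$, $\delta>0$, of the imaginary axis through the origin. It also contains a segment $\{t:|t|<\delta'\}$, $\delta'>0$, of the real axis; equivalently, the spectrum of the problem written with the other sign, $L_+p=\mu q$, $L_-q=\mu p$, also contains a segment of the imaginary axis through the origin. -/

import Mathlib

noncomputable section

namespace NLSStability

/-- `ψ x t` satisfies `i ψ_t = -(1/2) ψ_xx + ε |ψ|² ψ + V ψ` at every point. -/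
def SolvesNLS (V : ℝ → ℝ) (ε : ℝ) (ψ : ℝ → ℝ → ℂ) : Prop :=
  ∀ x t : ℝ,
    Complex.I * deriv (fun s : ℝ => ψ x s) t =
      -(1 / 2 : ℂ) * deriv (deriv (fun y : ℝ => ψ y t)) x
        + (ε : ℂ) * ((‖ψ x t‖ ^ 2 : ℝ) : ℂ) * ψ x t + (V x : ℂ) * ψ x t

/-- `exp (-i ω t) φ x` is a nontrivial standing wave, with a real profile `φ` of class `C²`
that is periodic or antiperiodic with period one. -/
structure IsStandingWave (V : ℝ → ℝ) (ε ω : ℝ) (φ : ℝ → ℝ) : Prop where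
  contDiff : ContDiff ℝ 2 φ
  nontrivial : φ ≠ 0
  periodic_or_antiperiodic : (∀ x, φ (x + 1) = φ x) ∨ (∀ x, φ (x + 1) = -φ x)
  solves : SolvesNLS V ε (fun x t => Complex.exp (-Complex.I * (ω : ℂ) * (t : ℂ)) * (φ x : ℂ))

/-- The differential expression `-(1/2) ∂_xx + W`. -/
def schrodingerOp (W : ℝ → ℝ) (f : ℝ → ℂ) (x : ℝ) : ℂ :=
  -(1 / 2 : ℂ) * deriv (deriv f) x + (W x : ℂ) * f x

/-- The potential of `L₊ = -(1/2) ∂_xx + V + 3 ε |φ|² - ω`. -/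
def potentialPlus (V : ℝ → ℝ) (ε ω : ℝ) (φ : ℝ → ℝ) (x : ℝ) : ℝ :=
  V x + 3 * ε * |φ x| ^ 2 - ω

/-- The potential of `L₋ = -(1/2) ∂_xx + V + ε |φ|² - ω`. -/
def potentialMinus (V : ℝ → ℝ) (ε ω : ℝ) (φ : ℝ → ℝ) (x : ℝ) : ℝ :=
  V x + ε * |φ x| ^ 2 - ω

def Lplus (V : ℝ → ℝ) (ε ω : ℝ) (φ : ℝ → ℝ) (f : ℝ → ℂ) (x : ℝ) : ℂ :=
  schrodingerOp (potentialPlus V ε ω φ) f x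

def Lminus (V : ℝ → ℝ) (ε ω : ℝ) (φ : ℝ → ℝ) (f : ℝ → ℂ) (x : ℝ) : ℂ :=
  schrodingerOp (potentialMinus V ε ω φ) f x

/-- `ρ` is a Floquet multiplier of `-(1/2) f'' + W f = l f`, where `W` has period one
(that is, `ρ` is an eigenvalue of the monodromy matrix over one period). -/
def IsHillMultiplier (W : ℝ → ℝ) (l : ℝ) (ρ : ℂ) : Prop :=
  ∃ f : ℝ → ℂ, ContDiff ℝ 2 f ∧ f ≠ 0 ∧ (∀ x, f (x + 1) = ρ * f x) ∧
    ∀ x, schrodingerOp W f x = (l : ℂ) * f x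

/-- The Floquet spectrum of `-(1/2) ∂_xx + W`. -/
def hillSpectrum (W : ℝ → ℝ) : Set ℝ :=
  {l | ∃ ρ : ℂ, ‖ρ‖ = 1 ∧ IsHillMultiplier W l ρ}

/-- The band edges: the periodic and the antiperiodic eigenvalues. -/
def bandEdges (W : ℝ → ℝ) : Set ℝ :=
  {l | IsHillMultiplier W l 1 ∨ IsHillMultiplier W l (-1)}

/-- `[a, b]` is a band: an interval of spectrum between two consecutive band edges. Bands that
meet at a double point (a closed gap) count as two bands. -/
def IsBand (W : ℝ → ℝ) (a b : ℝ) : Prop :=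
  a < b ∧ a ∈ bandEdges W ∧ b ∈ bandEdges W ∧
    Set.Ioo a b ⊆ hillSpectrum W \ bandEdges W

/-- `l` lies in the interior of some band of `-(1/2) ∂_xx + W`. -/
def InBandInterior (W : ℝ → ℝ) (l : ℝ) : Prop :=
  ∃ a b : ℝ, IsBand W a b ∧ l ∈ Set.Ioo a b

/-- `ρ` is a Floquet multiplier of the system `L₊ p = -μ q`, `L₋ q = μ p`
(that is, `ρ` is an eigenvalue of its `4 × 4` monodromy matrix over one period). -/
def IsStabilityMultiplier (V : ℝ → ℝ) (ε ω : ℝ) (φ : ℝ → ℝ) (μ ρ : ℂ) : Prop :=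
  ∃ p q : ℝ → ℂ, ContDiff ℝ 2 p ∧ ContDiff ℝ 2 q ∧ (p ≠ 0 ∨ q ≠ 0) ∧
    (∀ x, p (x + 1) = ρ * p x) ∧ (∀ x, q (x + 1) = ρ * q x) ∧
    (∀ x, Lplus V ε ω φ p x = -μ * q x) ∧ (∀ x, Lminus V ε ω φ q x = μ * p x)

/-- The Floquet spectrum of the linearized stability problem: those `μ` for which there is a
Floquet multiplier on the unit circle. -/
def stabilitySpectrum (V : ℝ → ℝ) (ε ω : ℝ) (φ : ℝ → ℝ) : Set ℂ :=
  {μ | ∃ ρ : ℂ, ‖ρ‖ = 1 ∧ IsStabilityMultiplier V ε ω φ μ ρ}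

end NLSStability

end

/-! Let μ = tκ with t real and κ² real. Replacing q by κq turns the stability problem into L₊p =
-κ²t q, L₋q = t p, a real first order system with a real monodromy matrix M(t) preserving a fixed
symplectic form. Both claims follow from one argument, with κ = i and κ = 1. At t = 0 the system
decouples. The L₊ block has multipliers ρ, 1/ρ on the unit circle, nonreal because 0 is interior to
a band. The L₋ block has determinant one and the multiplier σ = ±1 carried by φ, so σ is double.
Since M(t) is real and symplectic, e^{-2iθ} det(e^{iθ} - M(t)) is a real function of θ, and at t = 0
it equals 4(cos θ - Re ρ)(cos θ - σ). The second factor keeps its sign for |cos θ| < 1 while the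
first changes sign. The sign change survives for small t, and a zero of the function is a unimodular
multiplier. The double multiplier σ may move anywhere, so no finer information on its splitting is
needed. `eventually_exists_unimodular_eigenvalue` is this sign argument;
`tendsto_linearODE_solution` gives the continuity in t; `exists_floquet_solution` turns eigenvectors
back into solutions. -/

namespace NLSStability

open Filter Topology

/-! ### Global linear equations in a Banach algebra: existence, uniqueness, dependence on the
coefficient -/

section LinearODE

variable {E : Type*} [NormedAddCommGroup E] [NormedSpace ℝ E]

/-- Integrating e^{2K|s|} gains a factor 1/(2K), which beats the bound K of the coefficient and
leaves the contraction constant 1/2 for Picard iteration on the whole line. -/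
lemma norm_integral_le_of_norm_le_exp {K C : ℝ} (hK : 0 < K) {h : ℝ → E}
    (hh : ∀ s, ‖h s‖ ≤ K * C * Real.exp (2 * K * |s|)) (x : ℝ) :
    ‖∫ s in (0 : ℝ)..x, h s‖ ≤ C / 2 * Real.exp (2 * K * |x|) := by
  have hC : 0 ≤ C := by
    have h0 := (norm_nonneg _).trans (hh 0)
    simp only [abs_zero, mul_zero, Real.exp_zero, mul_one] at h0
    exact nonneg_of_mul_nonneg_right h0 hK
  have key : ∀ y : ℝ, 0 ≤ y → ∀ g : ℝ → E, (∀ s, ‖g s‖ ≤ K * C * Real.exp (2 * K * |s|)) →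
      ‖∫ s in (0 : ℝ)..y, g s‖ ≤ C / 2 * Real.exp (2 * K * y) := by
    intro y hy g hg
    have hd : ∀ s ∈ Set.uIcc 0 y, HasDerivAt (fun s => C / 2 * Real.exp (2 * K * s))
        (K * C * Real.exp (2 * K * s)) s := by
      intro s _
      have := (((hasDerivAt_id s).const_mul (2 * K)).exp).const_mul (C / 2)
      refine this.congr_deriv ?_
      simp only [id]
      ring
    calc ‖∫ s in (0 : ℝ)..y, g s‖ ≤ ∫ s in (0 : ℝ)..y, K * C * Real.exp (2 * K * s) := by
          refine intervalIntegral.norm_integral_le_of_norm_le hy ?_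
            (Continuous.intervalIntegrable (by fun_prop) _ _)
          refine Filter.Eventually.of_forall fun s hs => ?_
          simpa [abs_of_pos hs.1] using hg s
      _ = C / 2 * Real.exp (2 * K * y) - C / 2 * Real.exp (2 * K * 0) :=
          intervalIntegral.integral_eq_sub_of_hasDerivAt hd
            (Continuous.intervalIntegrable (by fun_prop) _ _)
      _ ≤ C / 2 * Real.exp (2 * K * y) := sub_le_self _ (by positivity)
  rcases le_total 0 x with hx | hx
  · rw [abs_of_nonneg hx]
    exact key x hx h hh
  · have := key (-x) (by linarith) (fun s => h (-s)) (fun s => by simpa using hh (-s))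
    rw [intervalIntegral.integral_comp_neg (fun s => h s), neg_neg, neg_zero,
      intervalIntegral.integral_symm, norm_neg] at this
    rwa [abs_of_nonpos hx]

variable {R : Type*} [NormedRing R]

lemma lipschitzWith_mul_left {a : R} {K : ℝ} (hK : 0 ≤ K) (ha : ‖a‖ ≤ K) :
    LipschitzWith K.toNNReal (fun u : R => a * u) := by
  refine LipschitzWith.of_dist_le_mul fun u w => ?_
  rw [dist_eq_norm, dist_eq_norm, ← mul_sub, Real.coe_toNNReal _ hK]
  exact (norm_mul_le _ _).trans (by gcongr)

variable [NormedAlgebra ℝ R]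

/-- A linear differential equation with bounded continuous coefficient has a global solution. -/
theorem exists_linearODE_solution [CompleteSpace R] {A : ℝ → R} (hA : Continuous A) {K : ℝ}
    (hK : 0 < K) (hAK : ∀ x, ‖A x‖ ≤ K) :
    ∃ Φ : ℝ → R, Φ 0 = 1 ∧ ∀ x, HasDerivAt Φ (A x * Φ x) x := by
  have hcont : ∀ v : BoundedContinuousFunction ℝ R,
      Continuous fun s => A s * (Real.exp (2 * K * |s|) • v s) := fun v => by fun_prop
  have hexp : ∀ (x : ℝ) (e : R),
      ‖Real.exp (-(2 * K * |x|)) • e‖ = Real.exp (-(2 * K * |x|)) * ‖e‖ := fun x e => by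
    rw [norm_smul, Real.norm_of_nonneg (Real.exp_pos _).le]
  have hbd : ∀ (v : BoundedContinuousFunction ℝ R) (s : ℝ),
      ‖A s * (Real.exp (2 * K * |s|) • v s)‖ ≤ K * ‖v‖ * Real.exp (2 * K * |s|) := by
    intro v s
    refine (norm_mul_le _ _).trans ?_
    rw [norm_smul, Real.norm_of_nonneg (Real.exp_pos _).le]
    calc ‖A s‖ * (Real.exp (2 * K * |s|) * ‖v s‖)
        ≤ K * (Real.exp (2 * K * |s|) * ‖v‖) := by
          gcongr
          · exact hAK s
          · exact v.norm_coe_le_norm s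
      _ = _ := by ring
  have hint : ∀ (v : BoundedContinuousFunction ℝ R) (x : ℝ),
      ‖Real.exp (-(2 * K * |x|)) • ∫ s in (0 : ℝ)..x, A s * (Real.exp (2 * K * |s|) • v s)‖
        ≤ ‖v‖ / 2 := by
    intro v x
    rw [hexp]
    calc _ ≤ Real.exp (-(2 * K * |x|)) * (‖v‖ / 2 * Real.exp (2 * K * |x|)) := by
          gcongr
          exact norm_integral_le_of_norm_le_exp hK (hbd v) x
      _ = ‖v‖ / 2 := by
          rw [Real.exp_neg]
          field_simp
  -- The Picard map in the unknown v = e^{-2K|x|} Φ, so that it acts on bounded functions.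
  let T : BoundedContinuousFunction ℝ R → BoundedContinuousFunction ℝ R := fun v =>
    BoundedContinuousFunction.ofNormedAddCommGroup
      (fun x => Real.exp (-(2 * K * |x|)) •
        (1 + ∫ s in (0 : ℝ)..x, A s * (Real.exp (2 * K * |s|) • v s)))
      (by
        have := intervalIntegral.continuous_primitive (μ := MeasureTheory.volume)
          (fun a b => (hcont v).intervalIntegrable a b) 0
        fun_prop)
      (‖(1 : R)‖ + ‖v‖ / 2)
      (by
        intro x
        rw [smul_add]
        refine (norm_add_le _ _).trans (add_le_add ?_ (hint v x))
        rw [hexp]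
        refine mul_le_of_le_one_left (norm_nonneg _) (Real.exp_le_one_iff.2 ?_)
        have := abs_nonneg x
        nlinarith)
  have hT : ∀ v x, T v x = Real.exp (-(2 * K * |x|)) •
        (1 + ∫ s in (0 : ℝ)..x, A s * (Real.exp (2 * K * |s|) • v s)) := fun v x => rfl
  have hcontr : ContractingWith (1 / 2) T := by
    refine ⟨by rw [← NNReal.coe_lt_coe]; norm_num, LipschitzWith.of_dist_le_mul fun v w => ?_⟩
    rw [BoundedContinuousFunction.dist_le (by positivity)]
    intro x
    have hsub : T v x - T w x =
        Real.exp (-(2 * K * |x|)) • ∫ s in (0 : ℝ)..x, A s * (Real.exp (2 * K * |s|) • (v - w) s) := by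
      rw [hT, hT, ← smul_sub, add_sub_add_left_eq_sub,
        ← intervalIntegral.integral_sub ((hcont v).intervalIntegrable _ _)
          ((hcont w).intervalIntegrable _ _)]
      simp only [BoundedContinuousFunction.coe_sub, Pi.sub_apply, smul_sub, mul_sub]
    rw [dist_eq_norm, hsub, dist_eq_norm]
    refine (hint _ x).trans (le_of_eq ?_)
    push_cast
    ring
  obtain ⟨v, hv⟩ : ∃ v, T v = v := ⟨_, hcontr.fixedPoint_isFixedPt⟩
  have hΦ : ∀ x, Real.exp (2 * K * |x|) • v x =
      1 + ∫ s in (0 : ℝ)..x, A s * (Real.exp (2 * K * |s|) • v s) := by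
    intro x
    conv_lhs => rw [← hv, hT, smul_smul, ← Real.exp_add, add_neg_cancel, Real.exp_zero, one_smul]
  refine ⟨fun x => Real.exp (2 * K * |x|) • v x, by simpa using hΦ 0, fun x => ?_⟩
  have hd := ((hcont v).integral_hasStrictDerivAt 0 x).hasDerivAt.const_add (1 : R)
  exact hd.congr_of_eventuallyEq (Filter.Eventually.of_forall hΦ)

theorem linearODE_solution_unique {A : ℝ → R} {K : ℝ} (hAK : ∀ x, ‖A x‖ ≤ K)
    {Φ Ψ : ℝ → R} (hΦ : ∀ x, HasDerivAt Φ (A x * Φ x) x)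
    (hΨ : ∀ x, HasDerivAt Ψ (A x * Ψ x) x) (h0 : Φ 0 = Ψ 0) : Φ = Ψ := by
  have hK : 0 ≤ K := (norm_nonneg _).trans (hAK 0)
  exact ODE_solution_unique_univ (v := fun x u => A x * u) (s := fun _ => Set.univ) (t₀ := 0)
    (fun t => (lipschitzWith_mul_left hK (hAK t)).lipschitzOnWith)
    (fun t => ⟨hΦ t, trivial⟩) (fun t => ⟨hΨ t, trivial⟩) h0

/-- The solution at time one depends continuously on the coefficient. -/
theorem tendsto_linearODE_solution {A : ℝ → ℝ → R} {K C : ℝ}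
    (hAK : ∀ t, |t| ≤ 1 → ∀ x, ‖A t x‖ ≤ K) (hAC : ∀ t x, ‖A 0 x - A t x‖ ≤ C * |t|)
    {Φ : ℝ → ℝ → R} (hΦ0 : ∀ t, Φ t 0 = 1)
    (hΦ : ∀ t x, HasDerivAt (Φ t) (A t x * Φ t x) x) :
    Tendsto (fun t => Φ t 1) (𝓝 0) (𝓝 (Φ 0 1)) := by
  have hK : 0 ≤ K := (norm_nonneg _).trans (hAK 0 (by simp) 0)
  have hc : ∀ t, Continuous (Φ t) := fun t =>
    continuous_iff_continuousAt.2 fun x => (hΦ t x).continuousAt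
  obtain ⟨D, hD⟩ := (isCompact_Icc (a := (0 : ℝ)) (b := 1)).exists_bound_of_continuousOn
    (hc 0).continuousOn
  have hbound : ∀ t, |t| ≤ 1 →
      dist (Φ 0 1) (Φ t 1) ≤ gronwallBound 0 K.toNNReal (C * |t| * D) 1 := by
    intro t ht
    -- Φ 0 is regarded as an approximate solution of the equation with coefficient A t, with defect
    -- at most C|t|D on [0, 1].
    have := dist_le_of_approx_trajectories_ODE (v := fun x u => A t x * u) (K := K.toNNReal)
      (f := Φ 0) (g := Φ t) (f' := fun x => A 0 x * Φ 0 x) (g' := fun x => A t x * Φ t x)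
      (a := 0) (b := 1) (εf := C * |t| * D) (εg := 0) (δ := 0)
      (fun x => lipschitzWith_mul_left hK (hAK t ht x)) (hc 0).continuousOn
      (fun x _ => (hΦ 0 x).hasDerivWithinAt)
      (fun x hx => by
        rw [dist_eq_norm, ← sub_mul]
        refine (norm_mul_le _ _).trans (mul_le_mul (hAC t x) (hD x ⟨hx.1, hx.2.le⟩)
          (norm_nonneg _) ((norm_nonneg _).trans (hAC t x))))
      (hc t).continuousOn (fun x _ => (hΦ t x).hasDerivWithinAt) (fun x _ => by simp)
      (by simp [hΦ0]) 1 (by simp)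
    simpa using this
  rw [tendsto_iff_dist_tendsto_zero]
  have hlim : Tendsto (fun t : ℝ => gronwallBound 0 K.toNNReal (C * |t| * D) 1) (𝓝 0) (𝓝 0) := by
    have : Continuous fun t : ℝ => gronwallBound 0 K.toNNReal (C * |t| * D) 1 :=
      (gronwallBound_continuous_ε 0 K.toNNReal 1).comp (by fun_prop)
    simpa [gronwallBound_ε0_δ0] using this.tendsto 0
  refine squeeze_zero' (Filter.Eventually.of_forall fun _ => dist_nonneg) ?_ hlim
  filter_upwards [Metric.closedBall_mem_nhds (0 : ℝ) one_pos] with t ht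
  rw [dist_comm]
  exact hbound t (by simpa using ht)

end LinearODE

/-! ### Fundamental matrices of periodic linear systems -/

section MatrixODE

open scoped Matrix Matrix.Norms.Operator ComplexConjugate

variable {n : Type*} [Fintype n]

lemma hasDerivAt_matrix_iff {Φ : ℝ → Matrix n n ℂ} {Φ' : Matrix n n ℂ} {x : ℝ} :
    HasDerivAt Φ Φ' x ↔ ∀ i j, HasDerivAt (fun y => Φ y i j) (Φ' i j) x :=
  (hasDerivAt_pi (φ := Φ) (φ' := Φ')).trans (forall_congr' fun _ => hasDerivAt_pi)

variable [DecidableEq n]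

/-- `Φ` is the fundamental matrix, normalized at the origin, of `u' = A u`. -/
def IsFundamental (A Φ : ℝ → Matrix n n ℂ) : Prop :=
  Φ 0 = 1 ∧ ∀ x, HasDerivAt Φ (A x * Φ x) x

lemma exists_norm_le_of_periodic {A : ℝ → Matrix n n ℂ} (hA : Continuous A)
    (hper : ∀ x, A (x + 1) = A x) : ∃ K, 0 < K ∧ ∀ x, ‖A x‖ ≤ K := by
  have hp : Function.Periodic A 1 := hper
  obtain ⟨K, hK⟩ := (hp.isBounded_of_continuous one_ne_zero hA).exists_norm_le
  exact ⟨max K 1, by positivity, fun x => (hK _ ⟨x, rfl⟩).trans (le_max_left _ _)⟩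

lemma exists_isFundamental {A : ℝ → Matrix n n ℂ} (hA : Continuous A)
    (hper : ∀ x, A (x + 1) = A x) : ∃ Φ, IsFundamental A Φ := by
  obtain ⟨K, hK, hAK⟩ := exists_norm_le_of_periodic hA hper
  exact exists_linearODE_solution hA hK hAK

lemma eq_mul_of_isFundamental {A Φ Ψ : ℝ → Matrix n n ℂ} (hA : Continuous A)
    (hper : ∀ x, A (x + 1) = A x) (hΦ : IsFundamental A Φ)
    (hΨ : ∀ x, HasDerivAt Ψ (A x * Ψ x) x) (x : ℝ) : Ψ x = Φ x * Ψ 0 := by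
  obtain ⟨K, -, hAK⟩ := exists_norm_le_of_periodic hA hper
  refine congrFun (linearODE_solution_unique hAK hΨ (Ψ := fun x => Φ x * Ψ 0) (fun x => ?_)
    (by simp [hΦ.1])) x
  simpa [mul_assoc] using (hΦ.2 x).mul_const (Ψ 0)

lemma IsFundamental.add_one {A Φ : ℝ → Matrix n n ℂ} (hA : Continuous A)
    (hper : ∀ x, A (x + 1) = A x) (hΦ : IsFundamental A Φ) (x : ℝ) :
    Φ (x + 1) = Φ x * Φ 1 := by
  have := eq_mul_of_isFundamental hA hper hΦ (Ψ := fun y => Φ (y + 1)) (fun y => by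
    have h := (hΦ.2 (y + 1)).comp_add_const y 1
    rw [hper] at h
    exact h) x
  simpa using this

/-- The entrywise conjugate solves the same real equation with the same initial value. -/
lemma IsFundamental.map_conj {A Φ : ℝ → Matrix n n ℂ} (hA : Continuous A)
    (hper : ∀ x, A (x + 1) = A x) (hreal : ∀ x i j, conj (A x i j) = A x i j)
    (hΦ : IsFundamental A Φ) (x : ℝ) (i j : n) : conj (Φ x i j) = Φ x i j := by
  have := eq_mul_of_isFundamental hA hper hΦ (Ψ := fun y => (Φ y).map conj) (fun y => by
    rw [hasDerivAt_matrix_iff]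
    intro i j
    have h := hasDerivAt_matrix_iff.1 (hΦ.2 y) i j
    have h2 := (Complex.conjCLE : ℂ →L[ℝ] ℂ).hasFDerivAt.comp_hasDerivAt y h
    refine h2.congr_deriv ?_
    simp [Matrix.mul_apply, hreal]) x
  have h1 : (Φ 0).map conj = 1 := by
    rw [hΦ.1]
    exact Matrix.map_one _ (map_zero _) (map_one _)
  rw [h1, mul_one] at this
  exact congrFun (congrFun this i) j

/-- The derivative of ΦᵀJΦ is Φᵀ(AᵀJ + JA)Φ = 0. -/
lemma IsFundamental.transpose_mul_mul {A Φ : ℝ → Matrix n n ℂ} {J : Matrix n n ℂ}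
    (hJ : ∀ x, (A x)ᵀ * J + J * A x = 0) (hΦ : IsFundamental A Φ) (x : ℝ) :
    (Φ x)ᵀ * J * Φ x = J := by
  have hd : ∀ y, HasDerivAt (fun y => (Φ y)ᵀ * J * Φ y) 0 y := by
    intro y
    have hT : HasDerivAt (fun y => (Φ y)ᵀ) (A y * Φ y)ᵀ y :=
      hasDerivAt_matrix_iff.2 fun i j => hasDerivAt_matrix_iff.1 (hΦ.2 y) j i
    refine ((hT.mul_const J).mul (hΦ.2 y)).congr_deriv ?_
    have : (Φ y)ᵀ * ((A y)ᵀ * J + J * A y) * Φ y = 0 := by rw [hJ]; simp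
    rw [← this, Matrix.transpose_mul]
    noncomm_ring
  have := is_const_of_deriv_eq_zero (fun y => (hd y).differentiableAt) (fun y => (hd y).deriv) x 0
  simpa [hΦ.1] using this

lemma eq_mulVec_of_isFundamental {A Φ : ℝ → Matrix n n ℂ} (hA : Continuous A)
    (hper : ∀ x, A (x + 1) = A x) (hΦ : IsFundamental A Φ) {u : ℝ → n → ℂ}
    (hu : ∀ x i, HasDerivAt (fun y => u y i) ((A x *ᵥ u x) i) x) (x : ℝ) :
    u x = Φ x *ᵥ u 0 := by
  -- The vector is repeated in every column, so that uniqueness for matrix solutions applies.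
  have := eq_mul_of_isFundamental hA hper hΦ (Ψ := fun y => Matrix.of fun i _ => u y i)
    (fun y => hasDerivAt_matrix_iff.2 fun i _ => hu y i) x
  ext i
  exact congrFun (congrFun this i) i

lemma IsFundamental.hasDerivAt_mulVec {A Φ : ℝ → Matrix n n ℂ} (hΦ : IsFundamental A Φ)
    (v : n → ℂ) (x : ℝ) (i : n) :
    HasDerivAt (fun y => (Φ y *ᵥ v) i) ((A x *ᵥ (Φ x *ᵥ v)) i) x := by
  rw [Matrix.mulVec_mulVec]
  simp only [Matrix.mulVec, dotProduct]
  exact HasDerivAt.fun_sum fun j _ => (hasDerivAt_matrix_iff.1 (hΦ.2 x) i j).mul_const _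

lemma tendsto_isFundamental {A : ℝ → ℝ → Matrix n n ℂ} (hA : Continuous (A 0))
    (hper : ∀ x, A 0 (x + 1) = A 0 x) {B : Matrix n n ℂ} (hB : ∀ t x, A t x = A 0 x + (t : ℂ) • B)
    {Φ : ℝ → ℝ → Matrix n n ℂ} (hΦ : ∀ t, IsFundamental (A t) (Φ t)) :
    Tendsto (fun t => Φ t 1) (𝓝 0) (𝓝 (Φ 0 1)) := by
  obtain ⟨K, hK, hAK⟩ := exists_norm_le_of_periodic hA hper
  refine tendsto_linearODE_solution (A := A) (K := K + ‖B‖) (C := ‖B‖) (fun t ht x => ?_)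
    (fun t x => ?_) (fun t => (hΦ t).1) (fun t => (hΦ t).2)
  · rw [hB]
    refine (norm_add_le _ _).trans (add_le_add (hAK x) ?_)
    rw [norm_smul, Complex.norm_real, Real.norm_eq_abs]
    exact mul_le_of_le_one_left (norm_nonneg _) ht
  · rw [hB t x, sub_add_cancel_left, norm_neg, norm_smul, Complex.norm_real, Real.norm_eq_abs,
      mul_comm]

end MatrixODE

/-! ### Unimodular eigenvalues of real symplectic matrices -/

section Multipliers

open scoped Matrix ComplexConjugate

variable {n : Type*} [Fintype n] [DecidableEq n]

lemma det_sq_eq_one {J M : Matrix n n ℂ} (hJ : J.det ≠ 0) (h : Mᵀ * J * M = J) :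
    M.det ^ 2 = 1 := by
  have := congrArg Matrix.det h
  rw [Matrix.det_mul, Matrix.det_mul, Matrix.det_transpose] at this
  apply mul_right_cancel₀ hJ
  linear_combination this

/-- The characteristic polynomial of a real symplectic matrix is self-reciprocal. -/
lemma conj_det_sub {J M : Matrix n n ℂ} (hJ : J.det ≠ 0) (h : Mᵀ * J * M = J) (hM : M.det = 1)
    (hreal : ∀ i j, conj (M i j) = M i j) {z : ℂ} (hz : conj z * z = 1) :
    conj ((z • (1 : Matrix n n ℂ) - M).det) =
      (-conj z) ^ Fintype.card n * (z • (1 : Matrix n n ℂ) - M).det := by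
  have h1 : conj ((z • (1 : Matrix n n ℂ) - M).det) = (conj z • (1 : Matrix n n ℂ) - M).det := by
    rw [RingHom.map_det]
    congr 1
    ext i j
    by_cases hij : i = j <;> simp [hreal, hij]
  -- This matrix identity, from MᵀJM = J and |z| = 1, carries the self-reciprocity; determinants
  -- finish.
  have h2 : Mᵀ * J * (conj z • (1 : Matrix n n ℂ) - M) =
      (-conj z) • ((z • (1 : Matrix n n ℂ) - M)ᵀ * J) := by
    rw [mul_sub, h, Matrix.transpose_sub, Matrix.transpose_smul, Matrix.transpose_one, sub_mul,
      smul_sub, Matrix.smul_mul, smul_smul, neg_mul, hz]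
    simp
    abel
  have h3 := congrArg Matrix.det h2
  rw [Matrix.det_mul, Matrix.det_mul, Matrix.det_transpose, hM, Matrix.det_smul, Matrix.det_mul,
    Matrix.det_transpose] at h3
  rw [h1]
  apply mul_left_cancel₀ hJ
  linear_combination h3

/-- Determinant one forces the other eigenvalue to be 1/ρ; the factor ρ clears the denominator. -/
lemma det_sub_of_mulVec_eq {N : Matrix (Fin 2) (Fin 2) ℂ} (hN : N.det = 1) {ρ : ℂ}
    {v : Fin 2 → ℂ} (hv : v ≠ 0) (h : N *ᵥ v = ρ • v) (z : ℂ) :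
    ρ * (z • (1 : Matrix (Fin 2) (Fin 2) ℂ) - N).det = (z - ρ) * (ρ * z - 1) := by
  have h0 : (ρ • (1 : Matrix (Fin 2) (Fin 2) ℂ) - N).det = 0 :=
    Matrix.exists_mulVec_eq_zero_iff.1 ⟨v, hv, by
      rw [Matrix.sub_mulVec, Matrix.smul_mulVec, Matrix.one_mulVec, h, sub_self]⟩
  simp only [Matrix.det_fin_two, Matrix.sub_apply, Matrix.smul_apply, Matrix.one_apply_eq,
    smul_eq_mul, mul_one, ne_eq, zero_ne_one, one_ne_zero, not_false_eq_true,
    Matrix.one_apply_ne, mul_zero, zero_sub] at hN h0 ⊢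
  linear_combination (ρ - z) * hN + z * h0

lemma exists_mulVec_eq_of_det_eq_zero {M : Matrix n n ℂ} {z : ℂ}
    (h : (z • (1 : Matrix n n ℂ) - M).det = 0) : ∃ v, v ≠ 0 ∧ M *ᵥ v = z • v := by
  obtain ⟨v, hv, h⟩ := Matrix.exists_mulVec_eq_zero_iff.2 h
  refine ⟨v, hv, ?_⟩
  rw [Matrix.sub_mulVec, Matrix.smul_mulVec, Matrix.one_mulVec, sub_eq_zero] at h
  exact h.symm

/-- Near a real symplectic matrix that is the direct sum of a block with a pair of nonreal
unimodular eigenvalues `ρ, ρ⁻¹` and a block with a double eigenvalue `σ = ±1`, every real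
symplectic matrix has a unimodular eigenvalue. -/
theorem eventually_exists_unimodular_eigenvalue
    {J : Matrix (Fin 2 ⊕ Fin 2) (Fin 2 ⊕ Fin 2) ℂ} (hJ : J.det ≠ 0)
    {M : ℝ → Matrix (Fin 2 ⊕ Fin 2) (Fin 2 ⊕ Fin 2) ℂ} (h : ∀ t, (M t)ᵀ * J * M t = J)
    (hreal : ∀ t i j, conj (M t i j) = M t i j) (hM : Tendsto M (𝓝 0) (𝓝 (M 0)))
    {P Q : Matrix (Fin 2) (Fin 2) ℂ} (hPQ : M 0 = Matrix.fromBlocks P 0 0 Q)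
    (hP : P.det = 1) (hQ : Q.det = 1) {ρ σ : ℂ} (hρ : ‖ρ‖ = 1) (hρ1 : ρ ≠ 1) (hρ2 : ρ ≠ -1)
    (hσ : σ = 1 ∨ σ = -1) {u v : Fin 2 → ℂ} (hu : u ≠ 0) (hv : v ≠ 0) (hPu : P *ᵥ u = ρ • u)
    (hQv : Q *ᵥ v = σ • v) :
    ∀ᶠ t in 𝓝 0, ∃ z : ℂ, ‖z‖ = 1 ∧ ∃ w, w ≠ 0 ∧ M t *ᵥ w = z • w := by
  let D : ℝ → ℂ → ℂ := fun t z => (z • (1 : Matrix (Fin 2 ⊕ Fin 2) (Fin 2 ⊕ Fin 2) ℂ) - M t).det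
  let e : ℝ → ℂ := fun θ => Complex.exp (θ * Complex.I)
  -- Dividing by e^{2iθ}, half the degree four, makes the self-reciprocal polynomial real on the
  -- circle.
  let g : ℝ → ℝ → ℂ := fun t θ => conj (e θ) ^ 2 * D t (e θ)
  have he : ∀ θ, conj (e θ) * e θ = 1 := fun θ => by
    rw [← Complex.normSq_eq_conj_mul_self, Complex.normSq_eq_norm_sq,
      Complex.norm_exp_ofReal_mul_I]
    simp
  have hesum : ∀ θ, conj (e θ) + e θ = 2 * (Real.cos θ : ℂ) := fun θ => by
    rw [add_comm, Complex.add_conj, Complex.exp_ofReal_mul_I_re]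
    push_cast
    ring
  -- Invariance of the form gives only det = ±1; continuity from t = 0 selects the sign.
  have hdet : ∀ᶠ t in 𝓝 0, (M t).det = 1 := by
    have h0 : (M 0).det = 1 := by
      rw [hPQ, Matrix.det_fromBlocks_zero₂₁, hP, hQ, one_mul]
    have hc : Tendsto (fun t => (M t).det) (𝓝 0) (𝓝 1) := by
      rw [← h0]
      exact ((continuous_id.matrix_det).tendsto (M 0)).comp hM
    filter_upwards [hc.eventually_ne (show (1 : ℂ) ≠ -1 by norm_num)] with t ht
    exact (mul_self_eq_one_iff.1 (by rw [← sq, det_sq_eq_one hJ (h t)])).resolve_right ht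
  have hgreal : ∀ t, (M t).det = 1 → ∀ θ, (g t θ).im = 0 := by
    intro t ht θ
    rw [← Complex.conj_eq_iff_im]
    have := conj_det_sub hJ (h t) ht (hreal t) (he θ)
    simp only [g, D, map_mul, map_pow, Complex.conj_conj, this, Fintype.card_sum,
      Fintype.card_fin]
    linear_combination (conj (e θ) ^ 2 * (e θ • (1 : Matrix (Fin 2 ⊕ Fin 2) (Fin 2 ⊕ Fin 2) ℂ)
      - M t).det * (conj (e θ) * e θ + 1)) * he θ
  have hg0 : ∀ θ, g 0 θ =
      ((4 * (Real.cos θ - ρ.re) * (Real.cos θ - σ.re) : ℝ) : ℂ) := by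
    intro θ
    have hρ' : conj ρ * ρ = 1 := by
      rw [← Complex.normSq_eq_conj_mul_self, Complex.normSq_eq_norm_sq, hρ]
      simp
    have hρsum : conj ρ + ρ = 2 * (ρ.re : ℂ) := by
      rw [add_comm, Complex.add_conj]
      push_cast
      ring
    have hD : D 0 (e θ) = (e θ • (1 : Matrix (Fin 2) (Fin 2) ℂ) - P).det *
        (e θ • (1 : Matrix (Fin 2) (Fin 2) ℂ) - Q).det := by
      simp only [D]
      rw [hPQ, ← Matrix.fromBlocks_one, Matrix.fromBlocks_smul, sub_eq_add_neg,
        Matrix.fromBlocks_neg, Matrix.fromBlocks_add, smul_zero, neg_zero, add_zero,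
        ← sub_eq_add_neg, ← sub_eq_add_neg, Matrix.det_fromBlocks_zero₂₁]
    have hDP := det_sub_of_mulVec_eq hP hu hPu (e θ)
    have hDQ := det_sub_of_mulVec_eq hQ hv hQv (e θ)
    have h1 : conj (e θ) * (e θ • (1 : Matrix (Fin 2) (Fin 2) ℂ) - P).det =
        2 * (Real.cos θ : ℂ) - 2 * (ρ.re : ℂ) := by
      rw [← hesum, ← hρsum]
      generalize (e θ • (1 : Matrix (Fin 2) (Fin 2) ℂ) - P).det = d at hDP
      have hE := he θ
      generalize e θ = z at hDP hE
      have : d = (z - ρ) * (z - conj ρ) := by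
        linear_combination conj ρ * hDP + (z * (z - ρ) - d) * hρ'
      rw [this]
      linear_combination (z - conj ρ - ρ) * hE + conj z * hρ'
    have h2 : conj (e θ) * (e θ • (1 : Matrix (Fin 2) (Fin 2) ℂ) - Q).det =
        2 * (Real.cos θ : ℂ) - 2 * (σ.re : ℂ) := by
      rw [← hesum]
      have hE := he θ
      generalize (e θ • (1 : Matrix (Fin 2) (Fin 2) ℂ) - Q).det = d at hDQ
      generalize e θ = z at hDQ hE
      rcases hσ with rfl | rfl
      · simp only [Complex.one_re, Complex.ofReal_one]
        linear_combination conj z * hDQ + (z - 2) * hE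
      · simp only [Complex.neg_re, Complex.one_re, Complex.ofReal_neg, Complex.ofReal_one]
        linear_combination -conj z * hDQ + (z + 2) * hE
    simp only [g]
    rw [hD]
    simp only [Complex.ofReal_mul, Complex.ofReal_sub, Complex.ofReal_ofNat]
    linear_combination (conj (e θ) * (e θ • (1 : Matrix (Fin 2) (Fin 2) ℂ) - Q).det) * h1 +
      (2 * (Real.cos θ : ℂ) - 2 * (ρ.re : ℂ)) * h2
  have hre : -1 < ρ.re ∧ ρ.re < 1 := by
    have hsq : ρ.re ^ 2 + ρ.im ^ 2 = 1 := by
      have := Complex.normSq_eq_norm_sq ρ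
      rw [hρ, Complex.normSq_apply] at this
      linarith
    have hle : |ρ.re| ≤ 1 := (Complex.abs_re_le_norm ρ).trans hρ.le
    rw [abs_le] at hle
    refine ⟨lt_of_le_of_ne hle.1 fun hh => hρ2 ?_, lt_of_le_of_ne hle.2 fun hh => hρ1 ?_⟩
    · have : ρ.im = 0 := by rw [← hh] at hsq; nlinarith
      apply Complex.ext <;> simp [← hh, this]
    · have : ρ.im = 0 := by rw [hh] at hsq; nlinarith
      apply Complex.ext <;> simp [hh, this]
  -- The cosines of θ₁ and θ₂ are the midpoints of [-1, Re ρ] and [Re ρ, 1]: on opposite sides of Re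
  -- ρ, on the same side of σ.
  let θ₁ := Real.arccos ((ρ.re - 1) / 2)
  let θ₂ := Real.arccos ((ρ.re + 1) / 2)
  have hθ₁ : Real.cos θ₁ = (ρ.re - 1) / 2 := Real.cos_arccos (by linarith) (by linarith)
  have hθ₂ : Real.cos θ₂ = (ρ.re + 1) / 2 := Real.cos_arccos (by linarith) (by linarith)
  have hneg : (g 0 θ₁).re * (g 0 θ₂).re < 0 := by
    rw [hg0, hg0, Complex.ofReal_re, Complex.ofReal_re, hθ₁, hθ₂]
    have h1 : 0 < (1 + ρ.re) * (1 - ρ.re) := mul_pos (by linarith) (by linarith)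
    have h2 : 0 < ((ρ.re - 1) / 2 - σ.re) * ((ρ.re + 1) / 2 - σ.re) := by
      rcases hσ with rfl | rfl
      · simp only [Complex.one_re]
        exact mul_pos_of_neg_of_neg (by linarith) (by linarith)
      · simp only [Complex.neg_re, Complex.one_re]
        exact mul_pos (by linarith) (by linarith)
    nlinarith [mul_pos h1 h2]
  have hgt : ∀ θ, Tendsto (fun t => (g t θ).re) (𝓝 0) (𝓝 (g 0 θ).re) := by
    intro θ
    have hc : Continuous fun N : Matrix (Fin 2 ⊕ Fin 2) (Fin 2 ⊕ Fin 2) ℂ =>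
        (conj (e θ) ^ 2 * (e θ • (1 : Matrix (Fin 2 ⊕ Fin 2) (Fin 2 ⊕ Fin 2) ℂ) - N).det).re :=
      Complex.continuous_re.comp
        (continuous_const.mul (continuous_const.sub continuous_id).matrix_det)
    exact (hc.tendsto (M 0)).comp hM
  filter_upwards [hdet, ((hgt θ₁).mul (hgt θ₂)).eventually_lt_const hneg] with t ht hlt
  have hgc : Continuous fun θ => (g t θ).re := by
    have hec : Continuous e := by fun_prop
    exact Complex.continuous_re.comp (((Complex.continuous_conj.comp hec).pow 2).mul
      ((hec.smul continuous_const).sub continuous_const).matrix_det)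
  obtain ⟨θ, hθ⟩ : (0 : ℝ) ∈ Set.range fun θ => (g t θ).re := by
    rcases mul_neg_iff.1 hlt with hh | hh
    · exact mem_range_of_exists_le_of_exists_ge hgc ⟨θ₂, hh.2.le⟩ ⟨θ₁, hh.1.le⟩
    · exact mem_range_of_exists_le_of_exists_ge hgc ⟨θ₁, hh.1.le⟩ ⟨θ₂, hh.2.le⟩
  have hgz : g t θ = 0 := Complex.ext hθ (hgreal t ht θ)
  refine ⟨e θ, Complex.norm_exp_ofReal_mul_I θ, exists_mulVec_eq_of_det_eq_zero ?_⟩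
  have hne : conj (e θ) ≠ 0 := fun h0 => by simpa [h0] using he θ
  exact (mul_eq_zero.1 hgz).resolve_left (pow_ne_zero 2 hne)

end Multipliers

/-! ### The Hill equations and their coupling as first order systems -/

open scoped Matrix ComplexConjugate

/-- The coefficient matrix of `-(1/2) f'' + W f = 0` as a first order system. -/
def companion (W : ℝ → ℝ) (x : ℝ) : Matrix (Fin 2) (Fin 2) ℂ :=
  !![0, 1; 2 * (W x : ℂ), 0]

/-- The standard symplectic form on the plane. -/
def planeForm : Matrix (Fin 2) (Fin 2) ℂ :=
  !![0, 1; -1, 0]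

/-- The coupling of the two components in `coupledMatrix`. -/
def couplingMatrix (c : ℂ) : Matrix (Fin 2 ⊕ Fin 2) (Fin 2 ⊕ Fin 2) ℂ :=
  Matrix.fromBlocks 0 !![0, 0; -2 * c, 0] !![0, 0; -2, 0] 0

/-- The coefficient matrix of `-(1/2) p'' + W₊ p = c t q`, `-(1/2) q'' + W₋ q = t p` as a first
order system. -/
def coupledMatrix (Wp Wm : ℝ → ℝ) (c : ℂ) (t x : ℝ) :
    Matrix (Fin 2 ⊕ Fin 2) (Fin 2 ⊕ Fin 2) ℂ :=
  Matrix.fromBlocks (companion Wp x) 0 0 (companion Wm x) + (t : ℂ) • couplingMatrix c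

/-- The bilinear form preserved by the flow of `coupledMatrix`. -/
def coupledForm (c : ℂ) : Matrix (Fin 2 ⊕ Fin 2) (Fin 2 ⊕ Fin 2) ℂ :=
  Matrix.fromBlocks planeForm 0 0 (c • planeForm)

lemma continuous_companion {W : ℝ → ℝ} (hW : Continuous W) : Continuous (companion W) := by
  refine continuous_matrix fun i j => ?_
  fin_cases i <;> fin_cases j <;> simp [companion] <;> fun_prop

lemma companion_add_one {W : ℝ → ℝ} (hW : ∀ x, W (x + 1) = W x) (x : ℝ) :
    companion W (x + 1) = companion W x := by
  simp only [companion, hW]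

lemma continuous_coupledMatrix {Wp Wm : ℝ → ℝ} (hp : Continuous Wp) (hm : Continuous Wm) (c : ℂ)
    (t : ℝ) : Continuous (coupledMatrix Wp Wm c t) :=
  ((continuous_companion hp).matrix_fromBlocks continuous_const continuous_const
    (continuous_companion hm)).add continuous_const

lemma coupledMatrix_add_one {Wp Wm : ℝ → ℝ} (hp : ∀ x, Wp (x + 1) = Wp x)
    (hm : ∀ x, Wm (x + 1) = Wm x) (c : ℂ) (t x : ℝ) :
    coupledMatrix Wp Wm c t (x + 1) = coupledMatrix Wp Wm c t x := by
  simp only [coupledMatrix, companion_add_one hp, companion_add_one hm]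

lemma transpose_companion_mul (W : ℝ → ℝ) (x : ℝ) :
    (companion W x)ᵀ * planeForm + planeForm * companion W x = 0 := by
  ext i j
  fin_cases i <;> fin_cases j <;> simp [companion, planeForm, Matrix.mul_apply]

/-- The weight c on the second plane balances the coupling entries -2c and -2, so the t-terms
cancel. -/
lemma transpose_coupledMatrix_mul (Wp Wm : ℝ → ℝ) (c : ℂ) (t x : ℝ) :
    (coupledMatrix Wp Wm c t x)ᵀ * coupledForm c + coupledForm c * coupledMatrix Wp Wm c t x
      = 0 := by
  ext i j
  rcases i with i | i <;> rcases j with j | j <;> fin_cases i <;> fin_cases j <;>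
    simp [coupledMatrix, couplingMatrix, coupledForm, companion, planeForm, Matrix.mul_apply] <;>
    ring

lemma coupledMatrix_conj (Wp Wm : ℝ → ℝ) {c : ℂ} (hc : conj c = c) (t x : ℝ)
    (i j : Fin 2 ⊕ Fin 2) :
    conj (coupledMatrix Wp Wm c t x i j) = coupledMatrix Wp Wm c t x i j := by
  rcases i with i | i <;> rcases j with j | j <;> fin_cases i <;> fin_cases j <;>
    simp [coupledMatrix, couplingMatrix, companion, hc, Complex.conj_ofNat]

lemma det_planeForm : planeForm.det = 1 := by
  simp [planeForm, Matrix.det_fin_two]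

lemma det_coupledForm_ne_zero {c : ℂ} (hc : c ≠ 0) : (coupledForm c).det ≠ 0 := by
  rw [coupledForm, Matrix.det_fromBlocks_zero₂₁, Matrix.det_smul, det_planeForm]
  simpa using hc

/-- Constancy of the Wronskian: the (0,1) entry of ΦᵀJΦ is det Φ when J is `planeForm`. -/
lemma det_eq_one_of_isFundamental_companion {W : ℝ → ℝ} {Φ : ℝ → Matrix (Fin 2) (Fin 2) ℂ}
    (hΦ : IsFundamental (companion W) Φ) (x : ℝ) : (Φ x).det = 1 := by
  have := congrFun (congrFun (hΦ.transpose_mul_mul (transpose_companion_mul W) x) 0) 1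
  rw [Matrix.det_fin_two]
  simp only [Matrix.mul_apply, Fin.sum_univ_two, Matrix.transpose_apply, planeForm,
    Matrix.of_apply, Matrix.cons_val', Matrix.cons_val_zero, Matrix.cons_val_one,
    Matrix.cons_val_fin_one] at this
  linear_combination this

lemma isFundamental_fromBlocks {Wp Wm : ℝ → ℝ} {P Q : ℝ → Matrix (Fin 2) (Fin 2) ℂ}
    (hP : IsFundamental (companion Wp) P) (hQ : IsFundamental (companion Wm) Q) (c : ℂ) :
    IsFundamental (coupledMatrix Wp Wm c 0) fun x => Matrix.fromBlocks (P x) 0 0 (Q x) := by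
  refine ⟨by simp [hP.1, hQ.1], fun x => ?_⟩
  rw [hasDerivAt_matrix_iff]
  have h : coupledMatrix Wp Wm c 0 x * Matrix.fromBlocks (P x) 0 0 (Q x) =
      Matrix.fromBlocks (companion Wp x * P x) 0 0 (companion Wm x * Q x) := by
    simp [coupledMatrix, Matrix.fromBlocks_multiply]
  rw [h]
  rintro (i | i) (j | j)
  · exact hasDerivAt_matrix_iff.1 (hP.2 x) i j
  · exact hasDerivAt_const x 0
  · exact hasDerivAt_const x 0
  · exact hasDerivAt_matrix_iff.1 (hQ.2 x) i j

/-! ### Floquet solutions and eigenvectors of the period map -/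

/-- A Floquet multiplier is an eigenvalue of the period map. -/
lemma IsHillMultiplier.exists_mulVec_eq {W : ℝ → ℝ} (hW : Continuous W)
    (hper : ∀ x, W (x + 1) = W x) {Φ : ℝ → Matrix (Fin 2) (Fin 2) ℂ}
    (hΦ : IsFundamental (companion W) Φ) {ρ : ℂ} (h : IsHillMultiplier W 0 ρ) :
    ∃ v, v ≠ 0 ∧ Φ 1 *ᵥ v = ρ • v := by
  obtain ⟨f, hf, hf0, hfρ, hfeq⟩ := h
  have hd1 : ∀ x, HasDerivAt f (deriv f x) x := fun x =>
    (hf.differentiable (by norm_num) x).hasDerivAt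
  have hd2 : ∀ x, HasDerivAt (deriv f) (2 * (W x : ℂ) * f x) x := by
    intro x
    have hc : ContDiff ℝ 1 (deriv f) := ContDiff.deriv' hf
    refine (hc.differentiable (by norm_num) x).hasDerivAt.congr_deriv ?_
    have := hfeq x
    simp only [schrodingerOp, Complex.ofReal_zero, zero_mul] at this
    linear_combination (-2 : ℂ) * this
  let u : ℝ → Fin 2 → ℂ := fun x => ![f x, deriv f x]
  have hu : ∀ x, u x = Φ x *ᵥ u 0 := by
    refine eq_mulVec_of_isFundamental (continuous_companion hW) (companion_add_one hper) hΦ ?_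
    intro x i
    fin_cases i
    · simpa [u, companion] using hd1 x
    · simpa [u, companion, mul_comm] using hd2 x
  have hderiv : deriv f 1 = ρ * deriv f 0 := by
    have h1 : (fun x => f (x + 1)) = fun x => ρ * f x := funext hfρ
    have h2 := congrFun (congrArg deriv h1) 0
    rwa [deriv_comp_add_const, zero_add, deriv_const_mul _ (hd1 0).differentiableAt] at h2
  refine ⟨u 0, fun h0 => hf0 (funext fun x => ?_), ?_⟩
  · have := congrFun (hu x) 0
    simpa [h0, u] using this
  · rw [← hu 1]
    ext i
    fin_cases i
    · simpa [u] using hfρ 0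
    · simpa [u] using hderiv

/-- An eigenvalue of the period map is a Floquet multiplier. -/
lemma exists_floquet_solution {Wp Wm : ℝ → ℝ} (hp : Continuous Wp) (hm : Continuous Wm)
    (hpper : ∀ x, Wp (x + 1) = Wp x) (hmper : ∀ x, Wm (x + 1) = Wm x) {c : ℂ} {t : ℝ}
    {Φ : ℝ → Matrix (Fin 2 ⊕ Fin 2) (Fin 2 ⊕ Fin 2) ℂ}
    (hΦ : IsFundamental (coupledMatrix Wp Wm c t) Φ) {ρ : ℂ} {v : Fin 2 ⊕ Fin 2 → ℂ}
    (hv : v ≠ 0) (hρ : Φ 1 *ᵥ v = ρ • v) :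
    ∃ p q : ℝ → ℂ, ContDiff ℝ 2 p ∧ ContDiff ℝ 2 q ∧ (p ≠ 0 ∨ q ≠ 0) ∧
      (∀ x, p (x + 1) = ρ * p x) ∧ (∀ x, q (x + 1) = ρ * q x) ∧
      (∀ x, schrodingerOp Wp p x = c * t * q x) ∧ (∀ x, schrodingerOp Wm q x = t * p x) := by
  let u : ℝ → Fin 2 ⊕ Fin 2 → ℂ := fun x => Φ x *ᵥ v
  have hder : ∀ x i, HasDerivAt (fun y => u y i) ((coupledMatrix Wp Wm c t x *ᵥ u x) i) x :=
    fun x i => hΦ.hasDerivAt_mulVec v x i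
  have hcont : ∀ i, Continuous fun x => u x i := fun i =>
    continuous_iff_continuousAt.2 fun x => (hder x i).continuousAt
  have hper : ∀ x i, u (x + 1) i = ρ * u x i := by
    intro x i
    simp only [u]
    rw [hΦ.add_one (continuous_coupledMatrix hp hm c t) (coupledMatrix_add_one hpper hmper c t),
      ← Matrix.mulVec_mulVec, hρ, Matrix.mulVec_smul, Pi.smul_apply, smul_eq_mul]
  have hp1 : ∀ x, HasDerivAt (fun y => u y (.inl 0)) (u x (.inl 1)) x := fun x => by
    refine (hder x _).congr_deriv ?_
    simp [Matrix.mulVec, dotProduct, coupledMatrix, couplingMatrix, companion]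
  have hp2 : ∀ x, HasDerivAt (fun y => u y (.inl 1))
      (2 * (Wp x : ℂ) * u x (.inl 0) - 2 * c * t * u x (.inr 0)) x := fun x => by
    refine (hder x _).congr_deriv ?_
    simp [Matrix.mulVec, dotProduct, coupledMatrix, couplingMatrix, companion]
    ring
  have hq1 : ∀ x, HasDerivAt (fun y => u y (.inr 0)) (u x (.inr 1)) x := fun x => by
    refine (hder x _).congr_deriv ?_
    simp [Matrix.mulVec, dotProduct, coupledMatrix, couplingMatrix, companion]
  have hq2 : ∀ x, HasDerivAt (fun y => u y (.inr 1))
      (2 * (Wm x : ℂ) * u x (.inr 0) - 2 * t * u x (.inl 0)) x := fun x => by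
    refine (hder x _).congr_deriv ?_
    simp [Matrix.mulVec, dotProduct, coupledMatrix, couplingMatrix, companion]
    ring
  have hdp : deriv (fun y => u y (.inl 0)) = fun y => u y (.inl 1) :=
    funext fun x => (hp1 x).deriv
  have hdq : deriv (fun y => u y (.inr 0)) = fun y => u y (.inr 1) :=
    funext fun x => (hq1 x).deriv
  have hC2 : ∀ {f f' f'' : ℝ → ℂ}, (∀ x, HasDerivAt f (f' x) x) →
      (∀ x, HasDerivAt f' (f'' x) x) → Continuous f'' → ContDiff ℝ 2 f := by
    intro f f' f'' h1 h2 h3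
    have e1 : deriv f = f' := funext fun x => (h1 x).deriv
    have e2 : deriv f' = f'' := funext fun x => (h2 x).deriv
    rw [show (2 : WithTop ℕ∞) = 1 + 1 by norm_num, contDiff_succ_iff_deriv]
    refine ⟨fun x => (h1 x).differentiableAt, by simp, ?_⟩
    rw [e1, contDiff_one_iff_deriv, e2]
    exact ⟨fun x => (h2 x).differentiableAt, h3⟩
  have hc1 := hcont (.inl 0)
  have hc2 := hcont (.inr 0)
  refine ⟨fun x => u x (.inl 0), fun x => u x (.inr 0), hC2 hp1 hp2 (by fun_prop),
    hC2 hq1 hq2 (by fun_prop), ?_, fun x => hper x _, fun x => hper x _, fun x => ?_, fun x => ?_⟩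
  -- If p and q vanish identically, so do their derivatives, hence all four components of v.
  · by_contra! h
    refine hv ?_
    have hu0 : u 0 = v := by simp [u, hΦ.1]
    rw [← hu0]
    ext i
    rcases i with i | i <;> fin_cases i
    · exact congrFun h.1 0
    · have := congrFun hdp 0
      rw [h.1] at this
      simpa using this.symm
    · exact congrFun h.2 0
    · have := congrFun hdq 0
      rw [h.2] at this
      simpa using this.symm
  · rw [schrodingerOp, hdp, (hp2 x).deriv]
    ring
  · rw [schrodingerOp, hdq, (hq2 x).deriv]
    ring

/-! ### Standing waves and the stability spectrum -/

/-- The profile of a standing wave lies in the kernel of `L₋`. -/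
lemma IsStandingWave.exists_isHillMultiplier {V : ℝ → ℝ} {ε ω : ℝ} {φ : ℝ → ℝ}
    (hφ : IsStandingWave V ε ω φ) :
    ∃ σ : ℂ, (σ = 1 ∨ σ = -1) ∧ IsHillMultiplier (potentialMinus V ε ω φ) 0 σ := by
  have hC : ContDiff ℝ 2 fun x => (φ x : ℂ) := Complex.ofRealCLM.contDiff.comp hφ.contDiff
  have hne : (fun x => (φ x : ℂ)) ≠ 0 := fun h => hφ.nontrivial (funext fun x => by
    simpa using congrFun h x)
  have heq : ∀ x, schrodingerOp (potentialMinus V ε ω φ) (fun x => (φ x : ℂ)) x =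
      ((0 : ℝ) : ℂ) * (φ x : ℂ) := by
    intro x
    -- At time zero the phase is 1, and i∂_t contributes ωφ.
    have h := hφ.solves x 0
    have hd : HasDerivAt (fun s : ℝ => Complex.exp (-Complex.I * (ω : ℂ) * (s : ℂ)) * (φ x : ℂ))
        (-Complex.I * ω * φ x) 0 := by
      have h1 : HasDerivAt (fun s : ℝ => (s : ℂ)) 1 0 := Complex.ofRealCLM.hasDerivAt
      refine ((h1.const_mul (-Complex.I * (ω : ℂ))).cexp.mul_const (φ x : ℂ)).congr_deriv ?_
      simp
    rw [hd.deriv] at h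
    simp only [Complex.ofReal_zero, mul_zero, Complex.exp_zero, one_mul, Complex.norm_real,
      Real.norm_eq_abs] at h
    simp only [schrodingerOp, potentialMinus]
    push_cast at h ⊢
    linear_combination -h - (ω : ℂ) * φ x * Complex.I_sq
  rcases hφ.periodic_or_antiperiodic with hp | hp
  · exact ⟨1, Or.inl rfl, _, hC, hne, fun x => by simp [hp], heq⟩
  · exact ⟨-1, Or.inr rfl, _, hC, hne, fun x => by simp [hp], heq⟩

/-- For nonzero `κ` with real square, the points `t κ` with small real `t` lie in the stability
spectrum. -/
theorem exists_segment_subset_stabilitySpectrum {V : ℝ → ℝ} (hV : Continuous V)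
    (hVper : ∀ x, V (x + 1) = V x) {ε ω : ℝ} {φ : ℝ → ℝ} (hφ : IsStandingWave V ε ω φ)
    (hband : InBandInterior (potentialPlus V ε ω φ) 0) {κ : ℂ} (hκ0 : κ ≠ 0)
    (hκ : conj (κ ^ 2) = κ ^ 2) :
    ∃ δ : ℝ, 0 < δ ∧ ∀ t : ℝ, |t| < δ → (t : ℂ) * κ ∈ stabilitySpectrum V ε ω φ := by
  obtain ⟨a, b, ⟨-, -, -, hsub⟩, h0⟩ := hband
  obtain ⟨⟨ρ, hρ, hρmul⟩, hedge⟩ := hsub h0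
  obtain ⟨σ, hσ, hσmul⟩ := hφ.exists_isHillMultiplier
  have hφc : Continuous φ := hφ.contDiff.continuous
  have habs : ∀ x, |φ (x + 1)| = |φ x| := by
    rcases hφ.periodic_or_antiperiodic with hp | hp <;> intro x <;> simp [hp]
  have hp : Continuous (potentialPlus V ε ω φ) := by unfold potentialPlus; fun_prop
  have hm : Continuous (potentialMinus V ε ω φ) := by unfold potentialMinus; fun_prop
  have hpper : ∀ x, potentialPlus V ε ω φ (x + 1) = potentialPlus V ε ω φ x := fun x => by
    simp only [potentialPlus, hVper, habs]
  have hmper : ∀ x, potentialMinus V ε ω φ (x + 1) = potentialMinus V ε ω φ x := fun x => by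
    simp only [potentialMinus, hVper, habs]
  generalize hWp : potentialPlus V ε ω φ = Wp at *
  generalize hWm : potentialMinus V ε ω φ = Wm at *
  obtain ⟨P, hP⟩ := exists_isFundamental (continuous_companion hp) (companion_add_one hpper)
  obtain ⟨Q, hQ⟩ := exists_isFundamental (continuous_companion hm) (companion_add_one hmper)
  obtain ⟨u, hu, hPu⟩ := hρmul.exists_mulVec_eq hp hpper hP
  obtain ⟨v, hv, hQv⟩ := hσmul.exists_mulVec_eq hm hmper hQ
  -- The constant -κ² is the coupling left after q is replaced by κq; it is real even when κ is not.
  let A : ℝ → ℝ → Matrix (Fin 2 ⊕ Fin 2) (Fin 2 ⊕ Fin 2) ℂ := coupledMatrix Wp Wm (-κ ^ 2)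
  have hA : ∀ t, Continuous (A t) := continuous_coupledMatrix hp hm _
  have hAper : ∀ t x, A t (x + 1) = A t x := coupledMatrix_add_one hpper hmper _
  choose Φ hΦ using fun t => exists_isFundamental (hA t) (hAper t)
  have hΦ0 : Φ 0 1 = Matrix.fromBlocks (P 1) 0 0 (Q 1) := by
    have hPQ := isFundamental_fromBlocks hP hQ (-κ ^ 2)
    have := eq_mul_of_isFundamental (hA 0) (hAper 0) (hΦ 0) hPQ.2 1
    rw [this]
    simp [hP.1, hQ.1]
  have hlim : Tendsto (fun t => Φ t 1) (𝓝 0) (𝓝 (Φ 0 1)) :=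
    tendsto_isFundamental (hA 0) (hAper 0) (B := couplingMatrix (-κ ^ 2))
      (fun t x => by simp [A, coupledMatrix]) hΦ
  have hev := eventually_exists_unimodular_eigenvalue
    (det_coupledForm_ne_zero (neg_ne_zero.2 (pow_ne_zero 2 hκ0)))
    (fun t => (hΦ t).transpose_mul_mul (transpose_coupledMatrix_mul Wp Wm (-κ ^ 2) t) 1)
    (fun t => (hΦ t).map_conj (hA t) (hAper t)
      (coupledMatrix_conj Wp Wm (by rw [map_neg, hκ]) t) 1)
    hlim hΦ0 (det_eq_one_of_isFundamental_companion hP 1)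
    (det_eq_one_of_isFundamental_companion hQ 1) hρ
    -- A multiplier ±1 would make 0 a band edge of L₊.
    (fun h => hedge (Or.inl (h ▸ hρmul))) (fun h => hedge (Or.inr (h ▸ hρmul))) hσ hu hv hPu hQv
  obtain ⟨δ, hδ, hball⟩ := Metric.eventually_nhds_iff.1 hev
  refine ⟨δ, hδ, fun t ht => ?_⟩
  obtain ⟨z, hz, w, hw, hwz⟩ := hball (by simpa [Real.dist_eq] using ht)
  obtain ⟨p, q, hpC, hqC, hpq, hpz, hqz, hpe, hqe⟩ :=
    exists_floquet_solution hp hm hpper hmper (hΦ t) hw hwz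
  -- Undoing the rescaling: -κ²t q = -(tκ)(κq) and L₋(κq) = (tκ)p.
  refine ⟨z, hz, p, fun x => κ * q x, hpC, contDiff_const.mul hqC, ?_, hpz, fun x => ?_,
    fun x => ?_, fun x => ?_⟩
  · refine hpq.imp_right fun h hκq => h (funext fun x => ?_)
    simpa [hκ0] using congrFun hκq x
  · simp only [hqz]
    ring
  · rw [Lplus, hWp, hpe]
    ring
  · have hd : deriv (fun x => κ * q x) = fun x => κ * deriv q x :=
      funext fun x => deriv_const_mul_field _
    have := hqe x
    rw [Lminus, hWm]
    rw [schrodingerOp] at this ⊢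
    rw [hd, deriv_const_mul_field]
    linear_combination κ * this

end NLSStability

theorem theorem1 (V : ℝ → ℝ) (hV : Continuous V) (hVper : ∀ x, V (x + 1) = V x)
    (ε ω : ℝ) (φ : ℝ → ℝ) (hφ : NLSStability.IsStandingWave V ε ω φ)
    (hband : NLSStability.InBandInterior (NLSStability.potentialPlus V ε ω φ) 0) :
    (∃ δ : ℝ, 0 < δ ∧ ∀ t : ℝ, |t| < δ →
      (t : ℂ) * Complex.I ∈ NLSStability.stabilitySpectrum V ε ω φ) ∧
    (∃ δ : ℝ, 0 < δ ∧ ∀ t : ℝ, |t| < δ →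
      (t : ℂ) ∈ NLSStability.stabilitySpectrum V ε ω φ) := by
  refine ⟨NLSStability.exists_segment_subset_stabilitySpectrum hV hVper hφ hband
    Complex.I_ne_zero (by simp), ?_⟩
  simpa only [mul_one] using NLSStability.exists_segment_subset_stabilitySpectrum hV hVper hφ hband
    (κ := 1) one_ne_zero (by simp)
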